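/- For a finite group $G$ and an element $\sum_{g\in G} a_g g$ of the integral group ring $\mathbb Z[G]$, let $$\mathcal D_G\Big(\sum_{g\in G} a_g g\Big)=\det\big(a_{gh^{-1}}\big)_{g,h\in G}$$ be its group determinant; the values of $\mathcal D_G$ on $\mathbb Z[G]$ are called the integer group determinants of $G$. Let $$G_{13}=\langle X,Y,Z \mid Z^4=Y^4=X^2=1,\ XZ=Z^{-1}X,\ Z^2=Y^2,\ XY=YX,\ ZY=YZ\rangle$$ be SmallGroup(16,13) of the GAP library (the central product of the dihedral group $\langle X,Z\rangle$ of order eight and the cyclic group $\langle Y\rangle$ of order four), and let $D_8$ be the dihedral group of order eight. Then: 1. $G_{13}$ and $\mathbb Z_2\times D_8$ have the same set of integer group determinants. 2. $G_{13}$ and $\mathbb Z_2\times D_8$ are not isomorphic. In particular, the integer group determinants do not determine the group: it is not true that any two finite groups with the same set of integer group determinants are isomorphic. -/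

import Mathlib

/-- The group determinant `det (a_{g h⁻¹})_{g, h ∈ G}` of the element `∑ a_g g` of the integral
group ring `ℤ[G]` of a finite group `G`. -/
def groupDeterminant (G : Type*) [Group G] [Fintype G] [DecidableEq G]
    (a : MonoidAlgebra ℤ G) : ℤ :=
  (Matrix.of fun g h : G => a.coeff (g * h⁻¹)).det

open Classical in
/-- The set of integer group determinants of the finite group `G`: all values taken by the group
determinant on the integral group ring `ℤ[G]`. -/
def integerGroupDeterminants (G : Type*) [Group G] [Fintype G] : Set ℤ :=
  Set.range (groupDeterminant G)

namespace SmallGroup_16_13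

/-- The names of the three generators. -/
inductive Gen : Type
  | X | Y | Z

open FreeGroup in
/-- The relators of the presentation
`⟨X, Y, Z | Z⁴ = Y⁴ = X² = 1, X Z = Z⁻¹ X, Z² = Y², X Y = Y X, Z Y = Y Z⟩`,
each relation `u = v` being written as the relator `u * v⁻¹`. -/
def relators : Set (FreeGroup Gen) :=
  {of .Z ^ 4, of .Y ^ 4, of .X ^ 2,
    (of .X * of .Z) * ((of .Z)⁻¹ * of .X)⁻¹,
    of .Z ^ 2 * (of .Y ^ 2)⁻¹,
    (of .X * of .Y) * (of .Y * of .X)⁻¹,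
    (of .Z * of .Y) * (of .Y * of .Z)⁻¹}

end SmallGroup_16_13

/-- The group `SmallGroup(16,13)` of the GAP library: the central product of the dihedral group
`⟨X, Z⟩` of order eight and the cyclic group `⟨Y⟩` of order four, given by its presentation. -/
abbrev SmallGroup_16_13 : Type := PresentedGroup SmallGroup_16_13.relators

namespace SmallGroup_16_13

/-- Every element of the group is of the form `Z ^ i * Y ^ j * X ^ k`. -/
theorem exists_normal_form (g : SmallGroup_16_13) :
    ∃ (i j : Fin 4) (k : Fin 2),
      g = (PresentedGroup.of .Z) ^ (i : ℕ) * (PresentedGroup.of .Y) ^ (j : ℕ) *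
        (PresentedGroup.of .X) ^ (k : ℕ) := by
  set X : SmallGroup_16_13 := PresentedGroup.of .X with hX
  set Y : SmallGroup_16_13 := PresentedGroup.of .Y with hY
  set Z : SmallGroup_16_13 := PresentedGroup.of .Z with hZ
  have rel : ∀ r ∈ relators, PresentedGroup.mk relators r = 1 :=
    fun r hr => PresentedGroup.one_of_mem hr
  have hZ4 : Z ^ 4 = 1 := rel (FreeGroup.of .Z ^ 4) (by simp [relators])
  have hY4 : Y ^ 4 = 1 := rel (FreeGroup.of .Y ^ 4) (by simp [relators])
  have hX2 : X ^ 2 = 1 := rel (FreeGroup.of .X ^ 2) (by simp [relators])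
  have hXZ : X * Z = Z⁻¹ * X := mul_inv_eq_one.1 <|
    rel ((FreeGroup.of .X * FreeGroup.of .Z) * ((FreeGroup.of .Z)⁻¹ * FreeGroup.of .X)⁻¹)
      (by simp [relators])
  have hXY : X * Y = Y * X := mul_inv_eq_one.1 <|
    rel ((FreeGroup.of .X * FreeGroup.of .Y) * (FreeGroup.of .Y * FreeGroup.of .X)⁻¹)
      (by simp [relators])
  have hZY : Z * Y = Y * Z := mul_inv_eq_one.1 <|
    rel ((FreeGroup.of .Z * FreeGroup.of .Y) * (FreeGroup.of .Y * FreeGroup.of .Z)⁻¹)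
      (by simp [relators])
  have hXi : X⁻¹ = X := by rw [inv_eq_iff_mul_eq_one, ← sq, hX2]
  have hYi : Y⁻¹ = Y ^ 3 := by rw [inv_eq_iff_mul_eq_one, ← pow_succ', hY4]
  have hZi : Z⁻¹ = Z ^ 3 := by rw [inv_eq_iff_mul_eq_one, ← pow_succ', hZ4]
  have hXZn : ∀ n : ℕ, X * Z ^ n = Z ^ (3 * n) * X := by
    intro n
    have h : SemiconjBy X Z (Z ^ 3) := by rw [← hZi]; exact hXZ
    rw [pow_mul]
    exact h.pow_right n
  have cXY : Commute X Y := hXY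
  have cZY : Commute Z Y := hZY
  -- the elements of the required form, with arbitrary natural exponents
  let P : SmallGroup_16_13 → Prop := fun g => ∃ i j k : ℕ, g = Z ^ i * Y ^ j * X ^ k
  have PX : ∀ g, P g → P (X * g) := by
    rintro g ⟨i, j, k, rfl⟩
    refine ⟨3 * i, j, k + 1, ?_⟩
    calc X * (Z ^ i * Y ^ j * X ^ k) = (X * Z ^ i) * Y ^ j * X ^ k := by simp only [mul_assoc]
      _ = Z ^ (3 * i) * (X * Y ^ j) * X ^ k := by rw [hXZn]; simp only [mul_assoc]
      _ = Z ^ (3 * i) * Y ^ j * X ^ (k + 1) := by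
        rw [(cXY.pow_right j).eq, pow_succ']; simp only [mul_assoc]
  have PY : ∀ g, P g → P (Y * g) := by
    rintro g ⟨i, j, k, rfl⟩
    refine ⟨i, j + 1, k, ?_⟩
    rw [← mul_assoc, ← mul_assoc, ← (cZY.pow_left i).eq, pow_succ']
    simp only [mul_assoc]
  have PZ : ∀ g, P g → P (Z * g) := by
    rintro g ⟨i, j, k, rfl⟩
    refine ⟨i + 1, j, k, ?_⟩
    rw [pow_succ']
    simp only [mul_assoc]
  have Pgen : ∀ s : Gen, ∀ g, P g → P (PresentedGroup.of s * g) := by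
    rintro (_ | _ | _)
    exacts [PX, PY, PZ]
  have Pinv : ∀ s : Gen, ∀ g, P g → P ((PresentedGroup.of s)⁻¹ * g) := by
    rintro (_ | _ | _) g hg
    · change P (X⁻¹ * g)
      rw [hXi]; exact PX g hg
    · change P (Y⁻¹ * g)
      rw [hYi, pow_succ, pow_two, mul_assoc, mul_assoc]; exact PY _ (PY _ (PY _ hg))
    · change P (Z⁻¹ * g)
      rw [hZi, pow_succ, pow_two, mul_assoc, mul_assoc]; exact PZ _ (PZ _ (PZ _ hg))
  have hP : P g := by
    have hg : g ∈ Subgroup.closure (Set.range (PresentedGroup.of (rels := relators))) := by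
      rw [PresentedGroup.closure_range_of]; trivial
    induction hg using Subgroup.closure_induction_left with
    | one => exact ⟨0, 0, 0, by simp⟩
    | mul_left x hx y _ ih => obtain ⟨s, rfl⟩ := hx; exact Pgen s y ih
    | inv_mul_cancel x hx y _ ih => obtain ⟨s, rfl⟩ := hx; exact Pinv s y ih
  obtain ⟨i, j, k, rfl⟩ := hP
  refine ⟨⟨i % 4, Nat.mod_lt _ (by norm_num)⟩, ⟨j % 4, Nat.mod_lt _ (by norm_num)⟩,
    ⟨k % 2, Nat.mod_lt _ (by norm_num)⟩, ?_⟩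
  rw [pow_eq_pow_mod i hZ4, pow_eq_pow_mod j hY4, pow_eq_pow_mod k hX2]

instance : Finite SmallGroup_16_13 :=
  Finite.of_surjective
    (fun p : Fin 4 × Fin 4 × Fin 2 =>
      ((PresentedGroup.of .Z) ^ (p.1 : ℕ) * (PresentedGroup.of .Y) ^ (p.2.1 : ℕ) *
        (PresentedGroup.of .X) ^ (p.2.2 : ℕ) : SmallGroup_16_13))
    fun g => by
      obtain ⟨i, j, k, h⟩ := exists_normal_form g
      exact ⟨(i, j, k), h.symm⟩

noncomputable instance : Fintype SmallGroup_16_13 := Fintype.ofFinite _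

end SmallGroup_16_13

/-!
Both groups are central products of the dihedral group `⟨x, z⟩` of order eight and a group `⟨y⟩`,
with `y ^ 2 = 1` for `ℤ₂ × D₈` and `y ^ 2 = z ^ 2` for `SmallGroup(16,13)`. Splitting the regular
representation by the value of `z ^ 2` turns the group determinant into
`K(v + w) K(v - w) F(p, q) ^ 2`, where `K` is the determinant of the Klein four-group
`⟨x, z⟩ / ⟨z ^ 2⟩`, the vectors `p` and `q` are congruent to `v` and `w` modulo two, and
`F = S ^ 2 - 4 σ B ^ 2` depends on the group only through the sign `σ` by which `y ^ 2` acts where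
`z ^ 2` acts as `-1`.

The sign does not matter modulo the relevant powers of two, and the norm `(v + w) ⬝ᵥ (v + w)` modulo
four decides the shape of the determinant: it is `1` modulo sixteen if the norm is `1`, a product of
two integers congruent to `5` modulo eight if the norm is `3`, and divisible by `2 ^ 16` if the norm
is even. Explicit families realize all these integers for both signs.
-/

section Determinants

open Matrix

variable {R : Type*} [CommRing R]

/-- The product of the values at `w 0 + w 1 g + w 2 h + w 3 g h` of the four characters of the
Klein four-group `{1, g, h, g h}`, i.e. its group determinant. -/
def kleinDet (w : Fin 4 → R) : R :=
  (w 0 + w 1 + w 2 + w 3) * (w 0 + w 1 - w 2 - w 3) *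
    ((w 0 - w 1 + w 2 - w 3) * (w 0 - w 1 - w 2 + w 3))

/-- The polarization of the quadratic form `w ↦ det ρ(w 0 + w 1 z + w 2 x + w 3 z x)`, where `ρ` is
the two-dimensional irreducible representation of the dihedral group `⟨x, z⟩` of order eight. -/
def dihedralForm (v w : Fin 4 → R) : R :=
  v 0 * w 0 + v 1 * w 1 - v 2 * w 2 - v 3 * w 3

/-- The norm of `dihedralForm (p + ω q) (p + ω q)` from `R[ω]` to `R`, where `ω ^ 2 = σ`. -/
def faithfulDet (σ : R) (p q : Fin 4 → R) : R :=
  (dihedralForm p p + σ * dihedralForm q q) ^ 2 - 4 * σ * dihedralForm p q ^ 2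

/-- The group determinant of a central product `⟨x, y, z⟩` of the dihedral group `⟨x, z⟩` of order
eight and a group `⟨y⟩`, where `y ^ 2 = 1` for `σ = 1` and `y ^ 2 = z ^ 2` for `σ = -1`. The
coefficients of `g`, `z ^ 2 g`, `y g` and `z ^ 2 y g`, for `g` in `1, z, x, z x`, are the entries of
`a`, `b`, `c` and `d`. -/
def extensionDet (σ : R) (a b c d : Fin 4 → R) : R :=
  kleinDet (a + b + (c + d)) * kleinDet (a + b - (c + d)) * faithfulDet σ (a - b) (c - d) ^ 2

/-- The values of `extensionDet σ` on vectors over `R`. -/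
def extensionDeterminants (σ : R) : Set R :=
  {n | ∃ a b c d, extensionDet σ a b c d = n}

/-- The group matrix of the Klein four-group. -/
def kleinMatrix (w : Fin 4 → R) : Matrix (Fin 4) (Fin 4) R :=
  !![w 0, w 1, w 2, w 3; w 1, w 0, w 3, w 2; w 2, w 3, w 0, w 1; w 3, w 2, w 1, w 0]

/-- The group matrix of the dihedral group `⟨x, z⟩` of order eight twisted by its center: the
entries `f (s t⁻¹)`, for `s` and `t` in `1, z, x, z x`, of a function with `f (z ^ 2 g) = -f g`. -/
def faithfulMatrix (w : Fin 4 → R) : Matrix (Fin 4) (Fin 4) R :=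
  !![w 0, -w 1, w 2, w 3; w 1, w 0, w 3, -w 2; w 2, w 3, w 0, -w 1; w 3, -w 2, w 1, w 0]

theorem det_fromBlocks_sq_smul {n : Type*} [Fintype n] [DecidableEq n] (A B : Matrix n n R)
    (ω : R) :
    (fromBlocks A ((ω ^ 2) • B) B A).det = (A + ω • B).det * (A - ω • B).det := by
  have triangular : fromBlocks 1 (ω • (1 : Matrix n n R)) 0 1 * fromBlocks A ((ω ^ 2) • B) B A *
      fromBlocks 1 (-ω • (1 : Matrix n n R)) 0 1 =
        fromBlocks (A + ω • B) 0 B (A - ω • B) := by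
    simp only [fromBlocks_multiply, one_mul, mul_one, zero_mul, mul_zero, add_zero, zero_add,
      smul_mul_assoc, mul_smul_comm]
    congr 1 <;> module
  simpa using congrArg det triangular

theorem det_fromBlocks_swap {n : Type*} [Fintype n] [DecidableEq n] (A B : Matrix n n R) :
    (fromBlocks A B B A).det = (A + B).det * (A - B).det := by
  simpa using det_fromBlocks_sq_smul A B (1 : R)

theorem det_kleinMatrix (w : Fin 4 → R) : (kleinMatrix w).det = kleinDet w := by
  simp [kleinMatrix, kleinDet, det_succ_row_zero, Fin.sum_univ_succ, Fin.succAbove]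
  ring

theorem det_faithfulMatrix (w : Fin 4 → R) :
    (faithfulMatrix w).det = dihedralForm w w ^ 2 := by
  simp [faithfulMatrix, dihedralForm, det_succ_row_zero, Fin.sum_univ_succ, Fin.succAbove]
  ring

theorem det_fromBlocks_kleinMatrix (v w : Fin 4 → R) :
    (fromBlocks (kleinMatrix v) (kleinMatrix w) (kleinMatrix w) (kleinMatrix v)).det =
      kleinDet (v + w) * kleinDet (v - w) := by
  have add : kleinMatrix v + kleinMatrix w = kleinMatrix (v + w) := by
    simp [kleinMatrix]
  have sub : kleinMatrix v - kleinMatrix w = kleinMatrix (v - w) := by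
    simp [kleinMatrix]
  rw [det_fromBlocks_swap, add, sub, det_kleinMatrix, det_kleinMatrix]

theorem det_fromBlocks_sq_smul_faithfulMatrix (ω : R) (p q : Fin 4 → R) :
    (fromBlocks (faithfulMatrix p) ((ω ^ 2) • faithfulMatrix q) (faithfulMatrix q)
      (faithfulMatrix p)).det = faithfulDet (ω ^ 2) p q ^ 2 := by
  have add_smul (η : R) : faithfulMatrix p + η • faithfulMatrix q = faithfulMatrix (p + η • q) := by
    simp [faithfulMatrix, add_comm]
  have polarization (η : R) : dihedralForm (p + η • q) (p + η • q) =
      dihedralForm p p + 2 * η * dihedralForm p q + η ^ 2 * dihedralForm q q := by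
    simp only [dihedralForm, Pi.add_apply, Pi.smul_apply, smul_eq_mul]
    ring
  rw [det_fromBlocks_sq_smul, sub_eq_add_neg, ← neg_smul, add_smul, add_smul, det_faithfulMatrix,
    det_faithfulMatrix, polarization, polarization, faithfulDet]
  ring

/-- After adjoining a square root of `σ`, this is `det_fromBlocks_sq_smul_faithfulMatrix`. -/
theorem det_fromBlocks_smul_faithfulMatrix (σ : R) (p q : Fin 4 → R) :
    (fromBlocks (faithfulMatrix p) (σ • faithfulMatrix q) (faithfulMatrix q)
      (faithfulMatrix p)).det = faithfulDet σ p q ^ 2 := by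
  let φ : R →+* QuadraticAlgebra R σ 0 := algebraMap R _
  have omega_sq : (QuadraticAlgebra.omega : QuadraticAlgebra R σ 0) ^ 2 = φ σ := by
    ext <;> simp [φ, sq]
  have map_faithfulMatrix (w : Fin 4 → R) :
      (faithfulMatrix w).map φ = faithfulMatrix (φ ∘ w) := by
    refine Matrix.ext fun i j ↦ ?_
    fin_cases i <;> fin_cases j <;> simp [faithfulMatrix]
  apply QuadraticAlgebra.algebraMap_injective (a := σ) (b := 0)
  change φ _ = φ _
  rw [RingHom.map_det, RingHom.mapMatrix_apply, fromBlocks_map,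
    map_smul' _ _ _ (map_mul φ), map_faithfulMatrix, map_faithfulMatrix, ← omega_sq,
    det_fromBlocks_sq_smul_faithfulMatrix, omega_sq]
  simp [faithfulDet, dihedralForm, map_ofNat φ 4]

end Determinants

section GroupMatrix

open Matrix (of fromBlocks)

variable {G R ι : Type*} [Group G]

/-- The matrix of the quotients of the elements of the family `s`, with a function `f` applied to
each entry. It is a block of the matrix that defines the group determinant. -/
def quotientMatrix (f : G → R) (s : ι → G) : Matrix ι ι R :=
  of fun i j ↦ f (s i * (s j)⁻¹)

theorem groupDeterminant_eq_det_quotientMatrix [Fintype G] [DecidableEq G] [Fintype ι]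
    [DecidableEq ι] {s : ι → G} (hs : s.Bijective) (a : MonoidAlgebra ℤ G) :
    groupDeterminant G a = (quotientMatrix a.coeff s).det :=
  (Matrix.det_submatrix_equiv_self (Equiv.ofBijective s hs) _).symm

theorem quotientMatrix_sumElim_mul (f : G → R) {s : ι → G} {c : G} (hc : ∀ i, Commute c (s i)) :
    quotientMatrix f (Sum.elim s (c * s ·)) =
      fromBlocks (quotientMatrix f s) (quotientMatrix (fun g ↦ f (c⁻¹ * g)) s)
        (quotientMatrix (fun g ↦ f (c * g)) s) (quotientMatrix f s) := by
  have quotient (i j : ι) : s i * (c * s j)⁻¹ = c⁻¹ * (s i * (s j)⁻¹) := by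
    rw [mul_inv_rev, ← mul_assoc, ((hc i).mul_right (hc j).inv_right).inv_left.eq]
  ext (i | i) (j | j) <;> simp [quotientMatrix, mul_assoc, -mul_inv_rev, quotient]

theorem det_quotientMatrix_sumElim_mul [CommRing R] [Fintype ι] [DecidableEq ι] (f : G → R)
    {s : ι → G} {c : G} (hc : ∀ i, Commute c (s i)) (hcc : c * c = 1) :
    (quotientMatrix f (Sum.elim s (c * s ·))).det =
      (quotientMatrix (fun g ↦ f g + f (c * g)) s).det *
        (quotientMatrix (fun g ↦ f g - f (c * g)) s).det := by
  rw [quotientMatrix_sumElim_mul f hc, inv_eq_of_mul_eq_one_left hcc, det_fromBlocks_swap]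
  rfl

end GroupMatrix

/-- The transversal `1, z, x, z x` of the center of the dihedral group `⟨x, z⟩` of order eight. -/
def dihedralTransversal {G : Type*} [Group G] (x z : G) : Fin 4 → G :=
  ![1, z, x, z * x]

/-- The elements `g`, `y g`, `z ^ 2 g` and `z ^ 2 y g`, for `g` in `dihedralTransversal x z`. -/
def centralProductElements {G : Type*} [Group G] (x y z : G) :
    (Fin 4 ⊕ Fin 4) ⊕ (Fin 4 ⊕ Fin 4) → G :=
  let s := Sum.elim (dihedralTransversal x z) (y * dihedralTransversal x z ·)
  Sum.elim s (z ^ 2 * s ·)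

theorem map_comp_centralProductElements {G H : Type*} [Group G] [Group H] (φ : G →* H) (x y z : G) :
    φ ∘ centralProductElements x y z = centralProductElements (φ x) (φ y) (φ z) := by
  ext ((i | i) | (i | i)) <;> fin_cases i <;>
    simp [centralProductElements, dihedralTransversal]

/-- `G` has order sixteen and is generated by the generators `x` and `z` of a dihedral group of
order eight together with a central element `y` such that `y ^ 2 = 1` for even `ε` and
`y ^ 2 = z ^ 2` for odd `ε`. -/
structure IsDihedralCentralProduct {G : Type*} [Group G] (ε : ℕ) (x y z : G) : Prop where
  x_mul_x : x * x = 1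
  z_pow_four : z ^ 4 = 1
  x_mul_z : x * z = z⁻¹ * x
  commute_y_x : Commute y x
  commute_y_z : Commute y z
  y_mul_y : y * y = (z ^ 2) ^ ε
  bijective : (centralProductElements x y z).Bijective

theorem commute_dihedralTransversal {G : Type*} [Group G] {c x z : G} (hx : Commute c x)
    (hz : Commute c z) (i : Fin 4) : Commute c (dihedralTransversal x z i) := by
  fin_cases i
  exacts [.one_right c, hz, hx, hz.mul_right hx]

namespace IsDihedralCentralProduct

open Matrix (fromBlocks)

variable {G R : Type*} [Group G] {ε : ℕ} {x y z : G}

theorem z_sq_mul_z_sq (h : IsDihedralCentralProduct ε x y z) : z ^ 2 * z ^ 2 = 1 := by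
  rw [← pow_add, h.z_pow_four]

theorem commute_z_sq_x (h : IsDihedralCentralProduct ε x y z) : Commute (z ^ 2) x := by
  have semiconj : SemiconjBy x (z ^ 2) (z⁻¹ ^ 2) := SemiconjBy.pow_right h.x_mul_z 2
  rw [inv_pow, inv_eq_of_mul_eq_one_left h.z_sq_mul_z_sq] at semiconj
  exact semiconj.symm

theorem commute_z_sq_transversal (h : IsDihedralCentralProduct ε x y z) (i : Fin 4) :
    Commute (z ^ 2) (dihedralTransversal x z i) :=
  commute_dihedralTransversal h.commute_z_sq_x (Commute.pow_self z 2) i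

theorem commute_y_transversal (h : IsDihedralCentralProduct ε x y z) (i : Fin 4) :
    Commute y (dihedralTransversal x z i) :=
  commute_dihedralTransversal h.commute_y_x h.commute_y_z i

theorem inv_y (h : IsDihedralCentralProduct ε x y z) : y⁻¹ = (z ^ 2) ^ ε * y := by
  have commute : Commute y ((z ^ 2) ^ ε) := (h.commute_y_z.pow_right 2).pow_right ε
  rw [inv_eq_iff_mul_eq_one, ← commute.eq, ← mul_assoc, h.y_mul_y,
    ← (Commute.refl (z ^ 2)).mul_pow, h.z_sq_mul_z_sq, one_pow]

theorem transversal_mul_inv (h : IsDihedralCentralProduct ε x y z) (i j : Fin 4) :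
    dihedralTransversal x z i * (dihedralTransversal x z j)⁻¹ =
      !![1, z ^ 2 * z, x, z * x;
         z, 1, z * x, z ^ 2 * x;
         x, z * x, 1, z ^ 2 * z;
         z * x, z ^ 2 * x, z, 1] i j := by
  have inv_x : x⁻¹ = x := inv_eq_of_mul_eq_one_left h.x_mul_x
  have z_pow_four : z * (z * (z * z)) = 1 := by
    simpa only [pow_succ', pow_zero, mul_one] using h.z_pow_four
  have inv_z : z⁻¹ = z * (z * z) := inv_eq_of_mul_eq_one_right z_pow_four
  have x_mul_z_pow_three : x * (z * (z * z)) = z * x := by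
    rw [← inv_z, mul_inv_eq_iff_eq_mul, mul_assoc, h.x_mul_z, mul_inv_cancel_left]
  have x_mul_z_mul_x : x * (z * x) = z * (z * z) := by
    rw [← mul_assoc, h.x_mul_z, mul_assoc, h.x_mul_x, mul_one, inv_z]
  fin_cases i <;> fin_cases j <;>
    simp [dihedralTransversal, inv_x, inv_z, x_mul_z_pow_three, x_mul_z_mul_x, h.x_mul_x, mul_assoc,
      sq, z_pow_four]

theorem quotientMatrix_transversal_of_invariant (h : IsDihedralCentralProduct ε x y z) {f : G → R}
    (hf : ∀ g, f (z ^ 2 * g) = f g) :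
    quotientMatrix f (dihedralTransversal x z) = kleinMatrix (f ∘ dihedralTransversal x z) := by
  ext i j
  rw [quotientMatrix, Matrix.of_apply, h.transversal_mul_inv]
  fin_cases i <;> fin_cases j <;> simp [kleinMatrix, dihedralTransversal, hf]

theorem quotientMatrix_transversal_of_antiinvariant [CommRing R]
    (h : IsDihedralCentralProduct ε x y z) {f : G → R} (hf : ∀ g, f (z ^ 2 * g) = -f g) :
    quotientMatrix f (dihedralTransversal x z) = faithfulMatrix (f ∘ dihedralTransversal x z) := by
  ext i j
  rw [quotientMatrix, Matrix.of_apply, h.transversal_mul_inv]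
  fin_cases i <;> fin_cases j <;> simp [faithfulMatrix, dihedralTransversal, hf]

theorem det_quotientMatrix_of_invariant [CommRing R] (h : IsDihedralCentralProduct ε x y z)
    {f : G → R} (hf : ∀ g, f (z ^ 2 * g) = f g) :
    (quotientMatrix f (Sum.elim (dihedralTransversal x z) (y * dihedralTransversal x z ·))).det =
      kleinDet (f ∘ dihedralTransversal x z + fun i ↦ f (y * dihedralTransversal x z i)) *
        kleinDet (f ∘ dihedralTransversal x z - fun i ↦ f (y * dihedralTransversal x z i)) := by
  have invariant_pow (n : ℕ) (g : G) : f ((z ^ 2) ^ n * g) = f g := by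
    induction n with
    | zero => simp
    | succ n ih => rw [pow_succ', mul_assoc, hf, ih]
  have invariant_y (g : G) : f (y * (z ^ 2 * g)) = f (y * g) := by
    rw [(h.commute_y_z.pow_right 2).left_comm, hf]
  simp only [quotientMatrix_sumElim_mul f h.commute_y_transversal, h.inv_y, mul_assoc,
    invariant_pow]
  rw [h.quotientMatrix_transversal_of_invariant hf,
    h.quotientMatrix_transversal_of_invariant invariant_y, det_fromBlocks_kleinMatrix]
  rfl

theorem det_quotientMatrix_of_antiinvariant [CommRing R] (h : IsDihedralCentralProduct ε x y z)
    {f : G → R} (hf : ∀ g, f (z ^ 2 * g) = -f g) :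
    (quotientMatrix f (Sum.elim (dihedralTransversal x z) (y * dihedralTransversal x z ·))).det =
      faithfulDet ((-1) ^ ε) (f ∘ dihedralTransversal x z)
        (fun i ↦ f (y * dihedralTransversal x z i)) ^ 2 := by
  have antiinvariant_pow (n : ℕ) (g : G) : f ((z ^ 2) ^ n * g) = (-1) ^ n * f g := by
    induction n with
    | zero => simp
    | succ n ih => rw [pow_succ', mul_assoc, hf, ih, pow_succ', mul_assoc, neg_one_mul]
  have antiinvariant_y (g : G) : f (y * (z ^ 2 * g)) = -f (y * g) := by
    rw [(h.commute_y_z.pow_right 2).left_comm, hf]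
  have smul : quotientMatrix (fun g ↦ (-1) ^ ε * f (y * g)) (dihedralTransversal x z) =
      ((-1) ^ ε : R) • quotientMatrix (fun g ↦ f (y * g)) (dihedralTransversal x z) := rfl
  simp only [quotientMatrix_sumElim_mul f h.commute_y_transversal, h.inv_y, mul_assoc,
    antiinvariant_pow, smul]
  rw [h.quotientMatrix_transversal_of_antiinvariant hf,
    h.quotientMatrix_transversal_of_antiinvariant antiinvariant_y,
    det_fromBlocks_smul_faithfulMatrix]
  rfl

theorem groupDeterminant_eq [Fintype G] [DecidableEq G] (h : IsDihedralCentralProduct ε x y z)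
    (u : MonoidAlgebra ℤ G) :
    groupDeterminant G u =
      extensionDet ((-1) ^ ε) (fun i ↦ u.coeff (dihedralTransversal x z i))
        (fun i ↦ u.coeff (z ^ 2 * dihedralTransversal x z i))
        (fun i ↦ u.coeff (y * dihedralTransversal x z i))
        (fun i ↦ u.coeff (z ^ 2 * (y * dihedralTransversal x z i))) := by
  have commute_z_sq (i : Fin 4 ⊕ Fin 4) :
      Commute (z ^ 2) (Sum.elim (dihedralTransversal x z) (y * dihedralTransversal x z ·) i) := by
    rcases i with i | i
    exacts [h.commute_z_sq_transversal i,
      (h.commute_y_z.pow_right 2).symm.mul_right (h.commute_z_sq_transversal i)]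
  have z_sq_mul_z_sq_mul (g : G) : z ^ 2 * (z ^ 2 * g) = g := by
    rw [← mul_assoc, h.z_sq_mul_z_sq, one_mul]
  rw [groupDeterminant_eq_det_quotientMatrix h.bijective, centralProductElements,
    det_quotientMatrix_sumElim_mul _ commute_z_sq h.z_sq_mul_z_sq,
    h.det_quotientMatrix_of_invariant (fun g ↦ by rw [z_sq_mul_z_sq_mul, add_comm]),
    h.det_quotientMatrix_of_antiinvariant (fun g ↦ by rw [z_sq_mul_z_sq_mul, neg_sub])]
  rfl

theorem integerGroupDeterminants_eq_extensionDeterminants [Fintype G]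
    (h : IsDihedralCentralProduct ε x y z) :
    integerGroupDeterminants G = extensionDeterminants ((-1) ^ ε) := by
  classical
  ext n
  constructor
  · rintro ⟨u, rfl⟩
    exact ⟨_, _, _, _, (h.groupDeterminant_eq u).symm⟩
  · rintro ⟨a, b, c, d, rfl⟩
    let coeff : G → ℤ :=
      Sum.elim (Sum.elim a c) (Sum.elim b d) ∘ (Equiv.ofBijective _ h.bijective).symm
    have coeff_apply (i) : coeff (centralProductElements x y z i) =
        Sum.elim (Sum.elim a c) (Sum.elim b d) i :=
      congrArg _ (Equiv.ofBijective_symm_apply_apply _ h.bijective i)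
    refine ⟨.ofCoeff (Finsupp.equivFunOnFinite.symm coeff), (h.groupDeterminant_eq _).trans ?_⟩
    congr 1
    exacts [funext fun i ↦ coeff_apply (.inl (.inl i)), funext fun i ↦ coeff_apply (.inr (.inl i)),
      funext fun i ↦ coeff_apply (.inl (.inr i)), funext fun i ↦ coeff_apply (.inr (.inr i))]

end IsDihedralCentralProduct

section CommonDeterminants

open Matrix

/-- The set of values of both `extensionDet 1` and `extensionDet (-1)` on integral vectors. -/
def commonDeterminants : Set ℤ :=
  {n | n ≡ 1 [ZMOD 16] ∨ (∃ m l, m ≡ 5 [ZMOD 8] ∧ l ≡ 5 [ZMOD 8] ∧ n = m * l) ∨ 2 ^ 16 ∣ n}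

theorem mem_extensionDeterminants_of_modEq_one {n : ℤ} (σ : ℤ) (hn : n ≡ 1 [ZMOD 16]) :
    n ∈ extensionDeterminants σ := by
  obtain ⟨k, hk⟩ := hn.symm.dvd
  obtain rfl : n = 16 * k + 1 := by lia
  refine ⟨![k + 1, k, k, k], ![k, k, k, k], ![k, k, k, k], ![k, k, k, k], ?_⟩
  simp [extensionDet, kleinDet, faithfulDet, dihedralForm]
  ring

theorem mul_mem_extensionDeterminants {m l : ℤ} (σ : ℤ) (hm : m ≡ 5 [ZMOD 8])
    (hml : m ≡ l [ZMOD 16]) : m * l ∈ extensionDeterminants σ := by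
  obtain ⟨k, hk⟩ := hm.symm.dvd
  obtain ⟨j, hj⟩ := hml.dvd
  obtain rfl : m = 8 * (k + 1) - 3 := by lia
  obtain rfl : l = 8 * (k + 1 + 2 * j) - 3 := by lia
  refine ⟨![k + j, k + j, k + j, k + j + 1],
    ![k + j + 1, k + j + 1, k + j + 1, k + j + 1], ![-j, -j, -j, -j], ![-j, -j, -j, -j], ?_⟩
  simp [extensionDet, kleinDet, faithfulDet, dihedralForm]
  ring

theorem mem_extensionDeterminants_of_two_pow_sixteen_dvd {n σ : ℤ} (hσ : σ = 1 ∨ σ = -1)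
    (hn : 2 ^ 16 ∣ n) : n ∈ extensionDeterminants σ := by
  obtain ⟨m, rfl⟩ := hn
  obtain ⟨k, rfl | rfl | rfl | rfl⟩ :
      ∃ k, m = 4 * k ∨ m = 4 * k + 1 ∨ m = 4 * k + 2 ∨ m = 4 * k - 1 := ⟨(m + 1) / 4, by lia⟩
  · refine ⟨![k, k, k, k + 1], ![k, k + 1, k, k], ![k + 1, k, k - 1, k - 1], ![k, k, k - 1, k], ?_⟩
    rcases hσ with rfl | rfl <;> simp [extensionDet, kleinDet, faithfulDet, dihedralForm] <;> ring
  · refine ⟨![k + 1, k - 1, k, k], ![k, k, k, k], ![k, k, k + 1, k + 1], ![k, k, k + 1, k + 1], ?_⟩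
    rcases hσ with rfl | rfl <;> simp [extensionDet, kleinDet, faithfulDet, dihedralForm] <;> ring
  · refine ⟨![k + 1, k + 1, k + 1, k + 1], ![k + 1, k, k + 1, k], ![k, k, k + 1, k + 1],
      ![k - 1, k, k + 1, k], ?_⟩
    rcases hσ with rfl | rfl <;> simp [extensionDet, kleinDet, faithfulDet, dihedralForm] <;> ring
  · refine ⟨![k, k, k - 1, k], ![k - 1, k - 1, k - 1, k], ![k, k - 1, k, k + 1],
      ![k - 1, k, k + 1, k], ?_⟩
    rcases hσ with rfl | rfl <;> simp [extensionDet, kleinDet, faithfulDet, dihedralForm] <;> ring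

theorem commonDeterminants_subset {σ : ℤ} (hσ : σ = 1 ∨ σ = -1) :
    commonDeterminants ⊆ extensionDeterminants σ := by
  rintro n (hn | ⟨m, l, hm, hl, rfl⟩ | hn)
  · exact mem_extensionDeterminants_of_modEq_one σ hn
  · by_cases hml : m ≡ l [ZMOD 16]
    · exact mul_mem_extensionDeterminants σ hm hml
    · refine mem_extensionDeterminants_of_modEq_one σ ?_
      have residues : m % 16 = 5 ∧ l % 16 = 13 ∨ m % 16 = 13 ∧ l % 16 = 5 := by
        unfold Int.ModEq at *
        lia
      rcases residues with ⟨hm, hl⟩ | ⟨hm, hl⟩ <;> simp [Int.ModEq, Int.mul_emod, hm, hl]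
  · exact mem_extensionDeterminants_of_two_pow_sixteen_dvd hσ hn

/-- The polynomial `(kleinDet w - (w ⬝ᵥ w) ^ 2) / 4`. -/
def kleinCorrection {R : Type*} [CommRing R] (w : Fin 4 → R) : R :=
  2 * (w 0 * w 1 * w 2 * w 3) - (w 0 ^ 2 * w 1 ^ 2 + w 0 ^ 2 * w 2 ^ 2 + w 0 ^ 2 * w 3 ^ 2 +
    w 1 ^ 2 * w 2 ^ 2 + w 1 ^ 2 * w 3 ^ 2 + w 2 ^ 2 * w 3 ^ 2)

theorem kleinDet_eq_sq_add_correction {R : Type*} [CommRing R] (w : Fin 4 → R) :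
    kleinDet w = (w ⬝ᵥ w) ^ 2 + 4 * kleinCorrection w := by
  simp only [kleinDet, kleinCorrection, dotProduct, Fin.sum_univ_four]
  ring

theorem dotProduct_self_modEq_iff {ι : Type*} [Fintype ι] {n : ℕ} {w : ι → ℤ} {r : ℤ} :
    w ⬝ᵥ w ≡ r [ZMOD n] ↔ ((↑) ∘ w ⬝ᵥ (↑) ∘ w : ZMod n) = r := by
  rw [← ZMod.intCast_eq_intCast_iff]
  simp [dotProduct]

theorem kleinCorrection_modEq_iff {n : ℕ} {w : Fin 4 → ℤ} {r : ℤ} :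
    kleinCorrection w ≡ r [ZMOD n] ↔ kleinCorrection ((↑) ∘ w : Fin 4 → ZMod n) = r := by
  rw [← ZMod.intCast_eq_intCast_iff]
  simp [kleinCorrection]

theorem kleinDet_modEq_dotProduct_sq {w : Fin 4 → ℤ} (h : w ⬝ᵥ w ≡ 1 [ZMOD 4]) :
    kleinDet w ≡ (w ⬝ᵥ w) ^ 2 [ZMOD 16] := by
  have residue : ∀ v : Fin 4 → ZMod 4, v ⬝ᵥ v = (1 : ℤ) → kleinCorrection v = (0 : ℤ) := by
    decide +kernel
  have correction : kleinCorrection w ≡ 0 [ZMOD 4] :=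
    kleinCorrection_modEq_iff.2 (residue _ (dotProduct_self_modEq_iff.1 h))
  simpa [kleinDet_eq_sq_add_correction] using
    (correction.mul_left' (c := 4)).add_left ((w ⬝ᵥ w) ^ 2)

theorem kleinDet_modEq_five {w : Fin 4 → ℤ} (h : w ⬝ᵥ w ≡ 3 [ZMOD 4]) :
    kleinDet w ≡ 5 [ZMOD 8] := by
  have residue : ∀ v : Fin 4 → ZMod 4, v ⬝ᵥ v = (3 : ℤ) → kleinCorrection v = (1 : ℤ) := by
    decide +kernel
  have correction : kleinCorrection w ≡ 1 [ZMOD 4] :=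
    kleinCorrection_modEq_iff.2 (residue _ (dotProduct_self_modEq_iff.1 h))
  have odd : Odd (w ⬝ᵥ w) := Int.odd_iff.2 (h.of_dvd (by norm_num))
  have sq : (w ⬝ᵥ w) ^ 2 ≡ 1 [ZMOD 8] :=
    (Int.modEq_iff_dvd.2 (Int.eight_dvd_sq_sub_one_of_odd odd)).symm
  simpa [kleinDet_eq_sq_add_correction] using
    sq.add ((correction.mul_left' (c := 4)).of_mul_left 2)

theorem sq_sub_four_mul_sq_modEq {u : ℤ} (hu : Odd u) (t : ℤ) :
    (u ^ 2 - 4 * t) ^ 2 ≡ 1 + 8 * t [ZMOD 16] := by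
  obtain ⟨j, hj⟩ := Int.eight_dvd_sq_sub_one_of_odd hu
  rw [show u ^ 2 = 8 * j + 1 by lia]
  exact Int.modEq_iff_dvd.2 ⟨t - 4 * j ^ 2 - j + 4 * j * t - t ^ 2, by ring⟩

theorem dihedralForm_modEq_dotProduct {p q v w : Fin 4 → ℤ} (hp : ∀ i, p i ≡ v i [ZMOD 2])
    (hq : ∀ i, q i ≡ w i [ZMOD 2]) : dihedralForm p q ≡ v ⬝ᵥ w [ZMOD 2] := by
  have sum : p ⬝ᵥ q ≡ v ⬝ᵥ w [ZMOD 2] := Int.ModEq.sum fun i _ ↦ (hp i).mul (hq i)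
  refine .trans (Int.modEq_iff_dvd.2 ⟨p 2 * q 2 + p 3 * q 3, ?_⟩) sum
  simp only [dihedralForm, dotProduct, Fin.sum_univ_four]
  ring

theorem exists_half_characters {w : Fin 4 → ℤ} (h : Even (w ⬝ᵥ w)) :
    ∃ u : Fin 4 → ℤ, 2 * u 0 = ∑ i, w i ∧ u ⬝ᵥ u = w ⬝ᵥ w ∧ kleinDet w = 2 ^ 4 * ∏ i, u i := by
  have even_sum : Even (∑ i, w i) := by
    simpa [dotProduct, Fin.sum_univ_four, parity_simps] using h
  obtain ⟨k, hk⟩ := even_sum.two_dvd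
  have w_three : w 3 = 2 * k - w 0 - w 1 - w 2 := by
    rw [Fin.sum_univ_four] at hk
    lia
  refine ⟨![k, w 0 + w 1 - k, w 0 + w 2 - k, w 0 + w 3 - k], hk.symm, ?_, ?_⟩ <;>
    simp [kleinDet, dotProduct, Fin.sum_univ_four, Fin.prod_univ_four, w_three] <;> ring

theorem two_pow_four_dvd_kleinDet {w : Fin 4 → ℤ} (h : Even (w ⬝ᵥ w)) : 2 ^ 4 ∣ kleinDet w := by
  obtain ⟨u, -, -, hu⟩ := exists_half_characters h
  exact ⟨_, hu⟩

theorem two_pow_six_dvd_kleinDet {w : Fin 4 → ℤ} (h : w ⬝ᵥ w ≡ 2 [ZMOD 4]) :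
    2 ^ 6 ∣ kleinDet w := by
  have residue : ∀ v : Fin 4 → ZMod 4, v ⬝ᵥ v = (2 : ℤ) → ∏ i, v i = 0 := by decide +kernel
  obtain ⟨u, -, dotProduct_u, prod_u⟩ :=
    exists_half_characters (Int.even_iff.2 (h.of_dvd (by norm_num)))
  have four_dvd : 2 ^ 2 ∣ ∏ i, u i := by
    refine (ZMod.intCast_zmod_eq_zero_iff_dvd _ 4).1 ?_
    rw [← dotProduct_u] at h
    simpa using residue _ (dotProduct_self_modEq_iff.1 h)
  rw [prod_u, show 6 = 4 + 2 from rfl, pow_add]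
  exact mul_dvd_mul_left _ four_dvd

theorem two_pow_eight_dvd_kleinDet {w : Fin 4 → ℤ} (h : w ⬝ᵥ w ≡ 0 [ZMOD 4])
    (h_sum : 4 ∣ ∑ i, w i) : 2 ^ 8 ∣ kleinDet w := by
  have residue : ∀ v : Fin 4 → ZMod 4, v ⬝ᵥ v = (0 : ℤ) → 2 * v 0 = 0 → ∀ i, 2 * v i = 0 := by
    decide +kernel
  obtain ⟨u, sum_w, dotProduct_u, prod_u⟩ :=
    exists_half_characters (Int.even_iff.2 (h.of_dvd (by norm_num)))
  have even_u (i : Fin 4) : 2 ∣ u i := by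
    rw [← dotProduct_u] at h
    have := residue _ (dotProduct_self_modEq_iff.1 h)
      (by simpa [← sum_w] using (ZMod.intCast_zmod_eq_zero_iff_dvd _ 4).2 h_sum) i
    have : (4 : ℤ) ∣ 2 * u i := (ZMod.intCast_zmod_eq_zero_iff_dvd _ 4).1 (by simpa using this)
    lia
  have sixteen_dvd : ∏ _i : Fin 4, 2 ∣ ∏ i, u i :=
    Finset.prod_dvd_prod_of_dvd _ _ fun i _ ↦ even_u i
  rw [prod_u, show 8 = 4 + 4 from rfl, pow_add]
  exact mul_dvd_mul_left _ (by simpa using sixteen_dvd)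

theorem modEq_of_dotProduct_self_modEq_zero {w : Fin 4 → ℤ} (h : w ⬝ᵥ w ≡ 0 [ZMOD 4])
    (i j : Fin 4) : w i ≡ w j [ZMOD 2] := by
  have residue : ∀ v : Fin 4 → ZMod 4, v ⬝ᵥ v = (0 : ℤ) → ∀ i j, 2 * v i = 2 * v j := by
    decide +kernel
  have := residue _ (dotProduct_self_modEq_iff.1 h) i j
  have : 2 * w i ≡ 2 * w j [ZMOD 4] := (ZMod.intCast_eq_intCast_iff _ _ 4).1 (by simpa using this)
  exact Int.ModEq.mul_left_cancel' two_ne_zero this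

theorem dihedralForm_self_modEq {e : ℤ} {p q : Fin 4 → ℤ} (hp : Even (∑ i, p i))
    (hpq : ∀ i, q i ≡ p i + e [ZMOD 2]) : dihedralForm q q ≡ dihedralForm p p [ZMOD 4] := by
  obtain ⟨k, hk⟩ := hp.two_dvd
  choose r hr using fun i ↦ (hpq i).symm.dvd
  have q_eq (i : Fin 4) : q i = p i + e + 2 * r i := by linarith [hr i]
  have p_three : p 3 = 2 * k - p 0 - p 1 - p 2 := by
    rw [Fin.sum_univ_four] at hk
    lia
  refine (Int.modEq_iff_dvd.2 ⟨dihedralForm p r + dihedralForm r r + e * (p 0 + p 1 - k +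
    r 0 + r 1 - r 2 - r 3), ?_⟩).symm
  simp only [dihedralForm, q_eq, p_three]
  ring

theorem even_dihedralForm {e : ℤ} {p q : Fin 4 → ℤ} (hp : Even (∑ i, p i))
    (hpq : ∀ i, q i ≡ p i + e [ZMOD 2]) : Even (dihedralForm p q) := by
  have form : dihedralForm p q ≡ p ⬝ᵥ fun i ↦ p i + e [ZMOD 2] :=
    dihedralForm_modEq_dotProduct (fun _ ↦ rfl) hpq
  have dotProduct_eq : (p ⬝ᵥ fun i ↦ p i + e) = ∑ i, p i * (p i + 1) + (e - 1) * ∑ i, p i := by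
    rw [dotProduct, Finset.mul_sum, ← Finset.sum_add_distrib]
    exact Finset.sum_congr rfl fun i _ ↦ by ring
  have even : Even (p ⬝ᵥ fun i ↦ p i + e) := by
    rw [dotProduct_eq]
    exact (Finset.even_sum _ fun i _ ↦ Int.even_mul_succ_self (p i)).add (hp.mul_left _)
  exact Int.even_iff.2 (Eq.trans form (Int.even_iff.1 even))

theorem sixteen_dvd_faithfulDet {σ e : ℤ} {p q : Fin 4 → ℤ} (hσ : Odd σ) (hp : Even (∑ i, p i))
    (hpq : ∀ i, q i ≡ p i + e [ZMOD 2]) : 16 ∣ faithfulDet σ p q := by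
  obtain ⟨s, rfl⟩ := hσ
  obtain ⟨m, hm⟩ := (even_dihedralForm (e := 0) (q := p) hp fun i ↦ by simp).two_dvd
  obtain ⟨j, hj⟩ := (dihedralForm_self_modEq hp hpq).symm.dvd
  obtain ⟨b, hb⟩ := (even_dihedralForm hp hpq).two_dvd
  have form_q : dihedralForm q q = 2 * m + 4 * j := by lia
  refine ⟨((s + 1) * m + (2 * s + 1) * j) ^ 2 - (2 * s + 1) * b ^ 2, ?_⟩
  rw [faithfulDet, hm, form_q, hb]
  ring

section Congruences

variable {σ : ℤ} {v w p q : Fin 4 → ℤ}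

theorem dotProduct_sub_self_modEq (v w : Fin 4 → ℤ) :
    (v - w) ⬝ᵥ (v - w) ≡ (v + w) ⬝ᵥ (v + w) [ZMOD 4] := by
  refine Int.modEq_iff_dvd.2 ⟨v ⬝ᵥ w, ?_⟩
  simp only [dotProduct_add, add_dotProduct, dotProduct_sub, sub_dotProduct, dotProduct_comm w v]
  ring

theorem dihedralForm_add_mul_modEq (hσ : Odd σ) (hp : ∀ i, p i ≡ v i [ZMOD 2])
    (hq : ∀ i, q i ≡ w i [ZMOD 2]) :
    dihedralForm p p + σ * dihedralForm q q ≡ (v + w) ⬝ᵥ (v + w) [ZMOD 2] := by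
  have hσ : σ ≡ 1 [ZMOD 2] := Int.odd_iff.1 hσ
  refine ((dihedralForm_modEq_dotProduct hp hp).add
    (hσ.mul (dihedralForm_modEq_dotProduct hq hq))).trans (Int.modEq_iff_dvd.2 ⟨v ⬝ᵥ w, ?_⟩)
  simp only [dotProduct_add, add_dotProduct, dotProduct_comm w v]
  ring

theorem faithfulDet_sq_modEq (hσ : Odd σ) (hp : ∀ i, p i ≡ v i [ZMOD 2])
    (hq : ∀ i, q i ≡ w i [ZMOD 2]) (h : Odd ((v + w) ⬝ᵥ (v + w))) :
    faithfulDet σ p q ^ 2 ≡ 1 + 8 * (v ⬝ᵥ w) ^ 2 [ZMOD 16] := by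
  have odd : Odd (dihedralForm p p + σ * dihedralForm q q) :=
    Int.odd_iff.2 (Eq.trans (dihedralForm_add_mul_modEq hσ hp hq) (Int.odd_iff.1 h))
  have hσ : σ ≡ 1 [ZMOD 2] := Int.odd_iff.1 hσ
  have cross : 8 * (σ * dihedralForm p q ^ 2) ≡ 8 * (1 * (v ⬝ᵥ w) ^ 2) [ZMOD 8 * 2] :=
    (hσ.mul ((dihedralForm_modEq_dotProduct hp hq).pow 2)).mul_left'
  rw [faithfulDet, mul_assoc]
  exact (sq_sub_four_mul_sq_modEq odd _).trans (by simpa using cross.add_left 1)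

theorem four_dvd_faithfulDet (hσ : Odd σ) (hp : ∀ i, p i ≡ v i [ZMOD 2])
    (hq : ∀ i, q i ≡ w i [ZMOD 2]) (h : Even ((v + w) ⬝ᵥ (v + w))) : 4 ∣ faithfulDet σ p q := by
  have even : Even (dihedralForm p p + σ * dihedralForm q q) :=
    Int.even_iff.2 (Eq.trans (dihedralForm_add_mul_modEq hσ hp hq) (Int.even_iff.1 h))
  rw [faithfulDet, mul_assoc]
  exact dvd_sub (pow_dvd_pow_of_dvd even.two_dvd 2) (dvd_mul_right 4 _)

theorem kleinDet_mul_faithfulDet_sq_modEq_one (hσ : Odd σ) (hp : ∀ i, p i ≡ v i [ZMOD 2])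
    (hq : ∀ i, q i ≡ w i [ZMOD 2]) (h : (v + w) ⬝ᵥ (v + w) ≡ 1 [ZMOD 4]) :
    kleinDet (v + w) * kleinDet (v - w) * faithfulDet σ p q ^ 2 ≡ 1 [ZMOD 16] := by
  have odd : Odd ((v + w) ⬝ᵥ (v + w)) := Int.odd_iff.2 (h.of_dvd (by norm_num))
  have odd_add : Odd (v ⬝ᵥ v + w ⬝ᵥ w) := by
    refine Int.odd_iff.2 (Eq.trans (Int.modEq_iff_dvd.2 ⟨v ⬝ᵥ w, ?_⟩) (Int.odd_iff.1 odd))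
    simp only [dotProduct_add, add_dotProduct, dotProduct_comm w v]
    ring
  have norms : (((v + w) ⬝ᵥ (v + w)) ^ 2 * ((v - w) ⬝ᵥ (v - w)) ^ 2 : ℤ) =
      ((v ⬝ᵥ v + w ⬝ᵥ w) ^ 2 - 4 * (v ⬝ᵥ w) ^ 2) ^ 2 := by
    simp only [dotProduct_add, add_dotProduct, dotProduct_sub, sub_dotProduct, dotProduct_comm w v]
    ring
  have klein : kleinDet (v + w) * kleinDet (v - w) ≡ 1 + 8 * (v ⬝ᵥ w) ^ 2 [ZMOD 16] := by
    refine ((kleinDet_modEq_dotProduct_sq h).mul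
      (kleinDet_modEq_dotProduct_sq ((dotProduct_sub_self_modEq v w).trans h))).trans ?_
    rw [norms]
    exact sq_sub_four_mul_sq_modEq odd_add _
  refine (klein.mul (faithfulDet_sq_modEq hσ hp hq odd)).trans (Int.modEq_iff_dvd.2
    ⟨-((v ⬝ᵥ w) ^ 2 + 4 * (v ⬝ᵥ w) ^ 4), ?_⟩)
  ring

theorem kleinDet_mul_faithfulDet_sq_modEq_five (hσ : Odd σ) (hp : ∀ i, p i ≡ v i [ZMOD 2])
    (hq : ∀ i, q i ≡ w i [ZMOD 2]) (h : (v + w) ⬝ᵥ (v + w) ≡ 3 [ZMOD 4]) :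
    kleinDet (v - w) * faithfulDet σ p q ^ 2 ≡ 5 [ZMOD 8] := by
  have odd : Odd ((v + w) ⬝ᵥ (v + w)) := Int.odd_iff.2 (h.of_dvd (by norm_num))
  have faithful : faithfulDet σ p q ^ 2 ≡ 1 [ZMOD 8] :=
    ((faithfulDet_sq_modEq hσ hp hq odd).of_mul_left 2).trans (by simp [Int.ModEq])
  exact (kleinDet_modEq_five ((dotProduct_sub_self_modEq v w).trans h)).mul faithful

theorem two_pow_sixteen_dvd_of_modEq_two (hσ : Odd σ) (hp : ∀ i, p i ≡ v i [ZMOD 2])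
    (hq : ∀ i, q i ≡ w i [ZMOD 2]) (h : (v + w) ⬝ᵥ (v + w) ≡ 2 [ZMOD 4]) :
    2 ^ 16 ∣ kleinDet (v + w) * kleinDet (v - w) * faithfulDet σ p q ^ 2 := by
  have even : Even ((v + w) ⬝ᵥ (v + w)) := Int.even_iff.2 (h.of_dvd (by norm_num))
  exact mul_dvd_mul (mul_dvd_mul (two_pow_six_dvd_kleinDet h)
    (two_pow_six_dvd_kleinDet ((dotProduct_sub_self_modEq v w).trans h)))
    (pow_dvd_pow_of_dvd (four_dvd_faithfulDet hσ hp hq even) 2)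

theorem two_pow_twelve_dvd_kleinDet_mul_kleinDet (h : (v + w) ⬝ᵥ (v + w) ≡ 0 [ZMOD 4])
    (hv : Odd (∑ i, v i)) : 2 ^ 12 ∣ kleinDet (v + w) * kleinDet (v - w) := by
  have h_sub : (v - w) ⬝ᵥ (v - w) ≡ 0 [ZMOD 4] := (dotProduct_sub_self_modEq v w).trans h
  have even_add : Even ((v + w) ⬝ᵥ (v + w)) := Int.even_iff.2 (h.of_dvd (by norm_num))
  have even_sub : Even ((v - w) ⬝ᵥ (v - w)) := Int.even_iff.2 (h_sub.of_dvd (by norm_num))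
  obtain ⟨u, sum_add, -⟩ := exists_half_characters even_add
  have sums : ∑ i, (v + w) i + ∑ i, (v - w) i = 2 * ∑ i, v i := by
    simp only [Pi.add_apply, Pi.sub_apply, Finset.sum_add_distrib, Finset.sum_sub_distrib]
    ring
  have four_dvd : 4 ∣ ∑ i, (v + w) i ∨ 4 ∣ ∑ i, (v - w) i := by
    obtain ⟨k, hk⟩ := hv
    lia
  rcases four_dvd with h_sum | h_sum
  · exact mul_dvd_mul (two_pow_eight_dvd_kleinDet h h_sum) (two_pow_four_dvd_kleinDet even_sub)
  · exact mul_dvd_mul (two_pow_four_dvd_kleinDet even_add) (two_pow_eight_dvd_kleinDet h_sub h_sum)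

theorem two_pow_sixteen_dvd_of_modEq_zero (hσ : Odd σ) (hp : ∀ i, p i ≡ v i [ZMOD 2])
    (hq : ∀ i, q i ≡ w i [ZMOD 2]) (h : (v + w) ⬝ᵥ (v + w) ≡ 0 [ZMOD 4]) :
    2 ^ 16 ∣ kleinDet (v + w) * kleinDet (v - w) * faithfulDet σ p q ^ 2 := by
  have even : Even ((v + w) ⬝ᵥ (v + w)) := Int.even_iff.2 (h.of_dvd (by norm_num))
  rcases (∑ i, v i).even_or_odd with hv | hv
  · have sum_p : Even (∑ i, p i) :=
      Int.even_iff.2 (Eq.trans (Int.ModEq.sum fun i _ ↦ hp i) (Int.even_iff.1 hv))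
    have shift (i : Fin 4) : q i ≡ p i + (v 0 + w 0) [ZMOD 2] := by
      have := modEq_of_dotProduct_self_modEq_zero h i 0
      have hp := hp i
      have hq := hq i
      simp only [Pi.add_apply, Int.ModEq] at *
      lia
    have even_sub : Even ((v - w) ⬝ᵥ (v - w)) :=
      Int.even_iff.2 (((dotProduct_sub_self_modEq v w).trans h).of_dvd (by norm_num))
    exact mul_dvd_mul
      (mul_dvd_mul (two_pow_four_dvd_kleinDet even) (two_pow_four_dvd_kleinDet even_sub))
      (pow_dvd_pow_of_dvd (sixteen_dvd_faithfulDet hσ sum_p shift) 2)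
  · exact mul_dvd_mul (two_pow_twelve_dvd_kleinDet_mul_kleinDet h hv)
      (pow_dvd_pow_of_dvd (four_dvd_faithfulDet hσ hp hq even) 2)

end Congruences

theorem extensionDeterminants_subset {σ : ℤ} (hσ : Odd σ) :
    extensionDeterminants σ ⊆ commonDeterminants := by
  rintro _ ⟨a, b, c, d, rfl⟩
  have sub_modEq_add (s t : Fin 4 → ℤ) (i : Fin 4) : (s - t) i ≡ (s + t) i [ZMOD 2] :=
    Int.modEq_iff_dvd.2 ⟨t i, by simp only [Pi.add_apply, Pi.sub_apply]; ring⟩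
  have hp := sub_modEq_add a b
  have hq := sub_modEq_add c d
  set N := (a + b + (c + d)) ⬝ᵥ (a + b + (c + d))
  have residues : N ≡ 0 [ZMOD 4] ∨ N ≡ 1 [ZMOD 4] ∨ N ≡ 2 [ZMOD 4] ∨ N ≡ 3 [ZMOD 4] := by
    simp only [Int.ModEq]
    lia
  rcases residues with h | h | h | h
  · exact .inr (.inr (two_pow_sixteen_dvd_of_modEq_zero hσ hp hq h))
  · exact .inl (kleinDet_mul_faithfulDet_sq_modEq_one hσ hp hq h)
  · exact .inr (.inr (two_pow_sixteen_dvd_of_modEq_two hσ hp hq h))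
  · exact .inr (.inl ⟨_, _, kleinDet_modEq_five h,
      kleinDet_mul_faithfulDet_sq_modEq_five hσ hp hq h, mul_assoc _ _ _⟩)

theorem extensionDeterminants_eq_commonDeterminants {σ : ℤ} (hσ : σ = 1 ∨ σ = -1) :
    extensionDeterminants σ = commonDeterminants := by
  refine (extensionDeterminants_subset ?_).antisymm (commonDeterminants_subset hσ)
  rcases hσ with rfl | rfl <;> decide

end CommonDeterminants

theorem IsDihedralCentralProduct.integerGroupDeterminants_eq_commonDeterminants {G : Type*}
    [Group G] [Fintype G] {ε : ℕ} {x y z : G} (h : IsDihedralCentralProduct ε x y z) :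
    integerGroupDeterminants G = commonDeterminants :=
  h.integerGroupDeterminants_eq_extensionDeterminants.trans
    (extensionDeterminants_eq_commonDeterminants (neg_one_pow_eq_or ℤ ε))

theorem isDihedralCentralProduct_two_prod_dihedral :
    IsDihedralCentralProduct (G := Multiplicative (ZMod 2) × DihedralGroup 4) 0
      (1, .sr 0) (.ofAdd 1, 1) (1, .r 1) where
  x_mul_x := by decide
  z_pow_four := by decide
  x_mul_z := by decide
  commute_y_x := (by decide : _ * _ = _ * _)
  commute_y_z := (by decide : _ * _ = _ * _)
  y_mul_y := by decide
  bijective := by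
    refine (Fintype.bijective_iff_injective_and_card _).2 ⟨?_, ?_⟩
    · unfold Function.Injective
      decide +kernel
    · simp [DihedralGroup.card, ZMod.card]

namespace SmallGroup_16_13

open PresentedGroup (of mk_eq_mk_of_mul_inv_mem one_of_mem)

theorem commute_of_Y (s : Gen) : Commute (of .Y : SmallGroup_16_13) (of s) := by
  cases s
  · exact .symm (mk_eq_mk_of_mul_inv_mem (by simp [relators]))
  · exact .refl _
  · exact .symm (mk_eq_mk_of_mul_inv_mem (by simp [relators]))

theorem Z_sq_eq_Y_sq : (of .Z ^ 2 : SmallGroup_16_13) = of .Y ^ 2 :=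
  mk_eq_mk_of_mul_inv_mem (by simp [relators])

theorem card_le_sixteen : Nat.card SmallGroup_16_13 ≤ 16 := by
  have surjective : Function.Surjective fun n : Fin 4 × Fin 2 × Fin 2 ↦
      (of .Z ^ (n.1 : ℕ) * of .Y ^ (n.2.1 : ℕ) * of .X ^ (n.2.2 : ℕ) : SmallGroup_16_13) := by
    intro g
    obtain ⟨i, j, k, rfl⟩ := exists_normal_form g
    have Z_pow_four : (of .Z ^ 4 : SmallGroup_16_13) = 1 := one_of_mem (by simp [relators])
    refine ⟨⟨Fin.ofNat 4 (i + 2 * (j / 2)), Fin.ofNat 2 j, k⟩, ?_⟩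
    simp only [Fin.val_ofNat]
    rw [← pow_eq_pow_mod _ Z_pow_four, pow_add, pow_mul, Z_sq_eq_Y_sq, ← pow_mul, mul_assoc (_ ^ _),
      ← pow_add, Nat.div_add_mod]
  simpa using Nat.card_le_card_of_surjective _ surjective

/-- The images of the generators under a faithful representation over the field with five elements,
in which `X` and `Z` act as symmetries of a square and `Y` as the square root `2` of `-1`. -/
def genMatrix : Gen → Matrix.GeneralLinearGroup (Fin 2) (ZMod 5)
  | .X => ⟨!![0, 1; 1, 0], !![0, 1; 1, 0], by decide, by decide⟩
  | .Y => ⟨!![2, 0; 0, 2], !![3, 0; 0, 3], by decide, by decide⟩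
  | .Z => ⟨!![0, -1; 1, 0], !![0, 1; -1, 0], by decide, by decide⟩

theorem lift_genMatrix_eq_one : ∀ r ∈ relators, FreeGroup.lift genMatrix r = 1 := by
  simp only [relators, Set.forall_mem_insert, Set.mem_singleton_iff, forall_eq, map_mul, map_pow,
    map_inv, FreeGroup.lift_apply_of]
  decide +kernel

theorem centralProductElements_injective :
    (centralProductElements (of .X) (of .Y) (of .Z) : _ → SmallGroup_16_13).Injective := by
  let ρ := PresentedGroup.toGroup lift_genMatrix_eq_one
  have injective :
      (centralProductElements (genMatrix .X) (genMatrix .Y) (genMatrix .Z)).Injective := by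
    unfold Function.Injective
    decide +kernel
  refine .of_comp (f := ρ) ?_
  simpa only [map_comp_centralProductElements, ρ, PresentedGroup.toGroup.of] using injective

theorem isDihedralCentralProduct :
    IsDihedralCentralProduct (G := SmallGroup_16_13) 1 (of .X) (of .Y) (of .Z) where
  x_mul_x := (sq _).symm.trans (one_of_mem (by simp [relators]))
  z_pow_four := one_of_mem (by simp [relators])
  x_mul_z := mk_eq_mk_of_mul_inv_mem (by simp [relators])
  commute_y_x := commute_of_Y .X
  commute_y_z := commute_of_Y .Z
  y_mul_y := by rw [← sq, pow_one, Z_sq_eq_Y_sq]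
  bijective :=
    centralProductElements_injective.bijective_of_nat_card_le (by simpa using card_le_sixteen)

theorem of_Y_mem_center : (of .Y : SmallGroup_16_13) ∈ Subgroup.center SmallGroup_16_13 := by
  refine Subgroup.mem_center_iff.2 fun g ↦ ?_
  obtain ⟨i, j, k, rfl⟩ := exists_normal_form g
  exact ((((commute_of_Y .Z).pow_right i).mul_right ((commute_of_Y .Y).pow_right j)).mul_right
    ((commute_of_Y .X).pow_right k)).symm

theorem of_Y_sq_ne_one : (of .Y ^ 2 : SmallGroup_16_13) ≠ 1 := by
  intro h
  have image := congrArg (PresentedGroup.toGroup lift_genMatrix_eq_one) h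
  rw [map_pow, map_one, PresentedGroup.toGroup.of] at image
  exact absurd image (by decide +kernel)

theorem isEmpty_mulEquiv_two_prod_dihedral :
    IsEmpty (SmallGroup_16_13 ≃* Multiplicative (ZMod 2) × DihedralGroup 4) := by
  have sq_eq_one : ∀ g : Multiplicative (ZMod 2) × DihedralGroup 4, (∀ x, x * g = g * x) →
      g ^ 2 = 1 := by
    decide +kernel
  refine ⟨fun e ↦ of_Y_sq_ne_one (e.injective ?_)⟩
  rw [map_pow, map_one]
  refine sq_eq_one _ fun x ↦ ?_
  obtain ⟨g, rfl⟩ := e.surjective x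
  rw [← map_mul, Subgroup.mem_center_iff.1 of_Y_mem_center, map_mul]

end SmallGroup_16_13

theorem mainTheorem2 :
    integerGroupDeterminants SmallGroup_16_13 =
        integerGroupDeterminants (Multiplicative (ZMod 2) × DihedralGroup 4) ∧
      IsEmpty (SmallGroup_16_13 ≃* Multiplicative (ZMod 2) × DihedralGroup 4) ∧
      ¬ ∀ (G H : Type) [Group G] [Fintype G] [Group H] [Fintype H],
          integerGroupDeterminants G = integerGroupDeterminants H → Nonempty (G ≃* H) := by
  have same_determinants := SmallGroup_16_13.isDihedralCentralProduct
    |>.integerGroupDeterminants_eq_commonDeterminants.trans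
      isDihedralCentralProduct_two_prod_dihedral.integerGroupDeterminants_eq_commonDeterminants.symm
  have not_isomorphic := SmallGroup_16_13.isEmpty_mulEquiv_two_prod_dihedral
  exact ⟨same_determinants, not_isomorphic,
    fun determined ↦ not_nonempty_iff.2 not_isomorphic (determined _ _ same_determinants)⟩
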